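/- Let $R$ be an integral domain containing $\mathbb{Z}$ as a subring. For a finite simple graph $G$ with vertex set $X$, let $M(X;G)$ be the partially commutative metabelian Lie $R$-algebra with defining graph $G$: the quotient of the free metabelian Lie $R$-algebra on $X$ by the ideal generated by all $[x,y]$ with $x,y$ adjacent in $G$. For $x\in X$ put $x^{\perp}=\{y\in X : d(x,y)\le 1\}$, where $d$ is the distance in $G$, and write $x\sim_{\perp}y$ if $x^{\perp}=y^{\perp}$. Two Lie $R$-algebras are called universally equivalent if they satisfy the same universal sentences $\forall w_1\dots\forall w_m\,\Phi$ ($\Phi$ quantifier-free) of the first-order language of Lie $R$-algebras (with symbols $0$, $+$, $-$, $[\cdot,\cdot]$, and a unary symbol for multiplication by each $r\in R$). For $Y\subseteq X$ let $G(Y)$ be the subgraph of $G$ induced on $Y$. 1. Let $x\in X$ be a vertex whose $\sim_{\perp}$-class has more than one element, $X'=X\setminus\{x\}$ and $G'=G(X')$. Then $M(X;G)$ and $M(X';G')$ are universally equivalent. 2. Let $S\subseteq X$ contain exactly one vertex of each $\sim_{\perp}$-class of $G$, so that $G(S)$ is a compaction of $G$. Then $M(X;G)$ and $M(S;G(S))$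 are universally equivalent. 3. The class of partially commutative metabelian Lie $R$-algebras whose defining graphs are trees is not separable by universal theory in the class of all partially commutative metabelian Lie $R$-algebras: there are a finite tree $T$ and a finite graph $H$ that is not a tree such that $M(V(T);T)$ and $M(V(H);H)$ are universally equivalent, and $M(V(H);H)$ is not isomorphic to $M(V(T');T')$ for any finite tree $T'$. -/

import Mathlib

universe u v w

/-- Function symbols of the language of Lie algebras over `R`. The scalars are unary symbols. -/
inductive LieFunctions (R : Type u) : ℕ → Type u
  | zero : LieFunctions R 0
  | neg : LieFunctions R 1
  | smul (r : R) : LieFunctions R 1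
  | add : LieFunctions R 2
  | bracket : LieFunctions R 2

/-- The first-order language of Lie algebras over `R`; equality is its only predicate. -/
def lieLanguage (R : Type u) : FirstOrder.Language.{u, 0} where
  Functions := LieFunctions R
  Relations := fun _ => Empty

/-- Every Lie algebra over `R` as a structure for the language of Lie algebras over `R`. -/
instance lieStructure (R : Type u) (L : Type v) [CommRing R] [LieRing L] [LieAlgebra R L] :
    (lieLanguage R).Structure L where
  funMap {_} f :=
    match f with
    | LieFunctions.zero => fun _ => 0
    | LieFunctions.neg => fun a => - a 0
    | LieFunctions.smul r => fun a => r • a 0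
    | LieFunctions.add => fun a => a 0 + a 1
    | LieFunctions.bracket => fun a => ⁅a 0, a 1⁆
  RelMap {_} r := nomatch r

/-- The universal theory of `L`: all true sentences of the form `∀ w₁ … ∀ wₘ, Φ`
with `Φ` quantifier-free. -/
def universalTheory (R : Type u) (L : Type v) [CommRing R] [LieRing L] [LieAlgebra R L] :
    Set (lieLanguage R).Sentence :=
  {φ | FirstOrder.Language.BoundedFormula.IsUniversal φ ∧ FirstOrder.Language.Sentence.Realize L φ}

/-- Two Lie algebras over `R` are universally equivalent if their universal theories coincide. -/
def UniversallyEquivalent (R : Type u) (L₁ : Type v) (L₂ : Type w) [CommRing R]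
    [LieRing L₁] [LieAlgebra R L₁] [LieRing L₂] [LieAlgebra R L₂] : Prop :=
  universalTheory R L₁ = universalTheory R L₂

/-- The free metabelian Lie algebra on `X`: the free Lie algebra modulo its second
derived ideal. -/
abbrev FreeMetabelianLieAlgebra (R : Type u) (X : Type v) [CommRing R] :=
  FreeLieAlgebra R X ⧸ LieAlgebra.derivedSeries R (FreeLieAlgebra R X) 2

/-- The generator `x` of the free metabelian Lie algebra. -/
noncomputable def freeMetabelianOf (R : Type u) {X : Type v} [CommRing R] (x : X) :
    FreeMetabelianLieAlgebra R X :=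
  LieSubmodule.Quotient.mk (FreeLieAlgebra.of R x)

/-- The ideal of the free metabelian Lie algebra generated by the brackets of adjacent vertices. -/
noncomputable def commutationIdeal (R : Type u) {X : Type v} [CommRing R] (G : SimpleGraph X) :
    LieIdeal R (FreeMetabelianLieAlgebra R X) :=
  LieSubmodule.lieSpan R (FreeMetabelianLieAlgebra R X)
    {z | ∃ x y : X, G.Adj x y ∧ z = ⁅freeMetabelianOf R x, freeMetabelianOf R y⁆}

/-- The partially commutative metabelian Lie algebra `M(X;G)` over `R`. -/
abbrev PCMetabelian (R : Type u) {X : Type v} [CommRing R] (G : SimpleGraph X) :=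
  FreeMetabelianLieAlgebra R X ⧸ commutationIdeal R G

/-- `x^⊥`: the vertices at distance at most one from `x`. -/
def perp {X : Type v} (G : SimpleGraph X) (x : X) : Set X :=
  {y | G.edist x y ≤ 1}

/-- `x ~⊥ y`. -/
def PerpEquiv {X : Type v} (G : SimpleGraph X) (x y : X) : Prop :=
  perp G x = perp G y

/-- The `~⊥`-class of `x`. -/
def perpClass {X : Type v} (G : SimpleGraph X) (x : X) : Set X :=
  {y | PerpEquiv G x y}

/-- `S` contains exactly one vertex of every `~⊥`-class, so that `G.induce S` is a
compaction of `G`. -/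
def IsPerpTransversal {X : Type v} (G : SimpleGraph X) (S : Set X) : Prop :=
  ∀ x : X, ∃! s : X, s ∈ S ∧ s ∈ perpClass G x

/-! Two algebras that discriminate each other are universally equivalent: a counterexample to a
universal sentence involves finitely many equations, and a homomorphism keeping finitely many
differences nonzero carries it over. An induced subgraph gives a retract of `M(X;G)`, hence one
direction. The other requires collapsing each class of twins without killing a given finite set.

The tool is the Lie algebra `[e, f] = f`. Over polynomial rings its points separate the elements of
`M(X;G)` (`exists_eval_ne_zero`): in a fixed multidegree, commutators are governed by the components
of the graph on their support, and one generic point per component detects them. Over a field,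
centralizers of nonzero elements are lines (`AffineLie.exists_smul_eq`), so twins, which commute,
take proportional values. Replacing the proportionality factors by indeterminates turns survival
under a scaled collapse into nonvanishing of a polynomial. Finitely many nonzero polynomials have a
common nonzero over the infinite domain `R`, which proves `isDiscriminatedBy_of_twins`.

For trees, double the centre of a three-vertex path. The linear parts of central elements then
contain two independent vectors, whereas for a tree with nonabelian algebra they involve at most one
vertex. -/

open FirstOrder

/-- A Lie algebra homomorphism as a homomorphism of first-order structures. -/
def LieHom.toLanguageHom {R : Type u} {L₁ : Type v} {L₂ : Type w} [CommRing R]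
    [LieRing L₁] [LieAlgebra R L₁] [LieRing L₂] [LieAlgebra R L₂] (f : L₁ →ₗ⁅R⁆ L₂) :
    L₁ →[lieLanguage R] L₂ where
  toFun := f
  map_fun' := by
    intro n g x
    cases g
    · exact f.map_zero
    · exact f.map_neg _
    · exact f.map_smul _ _
    · exact f.map_add _ _
    · exact f.map_lie _ _
  map_rel' := by
    intro n r
    exact nomatch r

/-- `L₁` is discriminated by `L₂`: every finite set of nonzero elements of `L₁` stays nonzero
under some homomorphism to `L₂`. -/
def IsDiscriminatedBy (R : Type u) (L₁ : Type v) (L₂ : Type w) [CommRing R]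
    [LieRing L₁] [LieAlgebra R L₁] [LieRing L₂] [LieAlgebra R L₂] : Prop :=
  ∀ F : Finset L₁, (∀ z ∈ F, z ≠ 0) → ∃ f : L₁ →ₗ⁅R⁆ L₂, ∀ z ∈ F, f z ≠ 0

/-! ### Discrimination and universal theories -/

section Discrimination

variable {R : Type u} {L₁ : Type v} {L₂ : Type w} [CommRing R]
  [LieRing L₁] [LieAlgebra R L₁] [LieRing L₂] [LieAlgebra R L₂]

theorem IsDiscriminatedBy.of_injective (f : L₁ →ₗ⁅R⁆ L₂) (hf : Function.Injective f) :
    IsDiscriminatedBy R L₁ L₂ :=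
  fun _ hF => ⟨f, fun z hz h => hF z hz (hf (h.trans f.map_zero.symm))⟩

/-- `F` collects the nonzero differences of the two sides of the equations in `φ`. Equations that
hold persist under every homomorphism, so only these differences need protection. -/
theorem exists_finset_realize_iff {α : Type*} {n : ℕ} {φ : (lieLanguage R).BoundedFormula α n}
    (hφ : φ.IsQF) (a : α → L₁) (xs : Fin n → L₁) :
    ∃ F : Finset L₁, (∀ z ∈ F, z ≠ 0) ∧ ∀ f : L₁ →ₗ⁅R⁆ L₂, (∀ z ∈ F, f z ≠ 0) →
      (φ.Realize (f ∘ a) (f ∘ xs) ↔ φ.Realize a xs) := by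
  classical
  induction hφ with
  | falsum => exact ⟨∅, by simp, fun f _ => Iff.rfl⟩
  | of_isAtomic h =>
    cases h with
    | rel r ts => exact nomatch r
    | equal t₁ t₂ =>
      set z := t₁.realize (Sum.elim a xs) - t₂.realize (Sum.elim a xs) with hz
      refine ⟨if z = 0 then ∅ else {z}, by split_ifs <;> simp_all, fun f hf => ?_⟩
      have key : ∀ t : (lieLanguage R).Term (α ⊕ Fin n),
          t.realize (Sum.elim (f ∘ a) (f ∘ xs)) = f (t.realize (Sum.elim a xs)) := by
        intro t
        rw [← Sum.comp_elim]
        exact Language.HomClass.realize_term f.toLanguageHom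
      rw [Language.BoundedFormula.realize_bdEqual, Language.BoundedFormula.realize_bdEqual,
        key, key, ← sub_eq_zero, ← map_sub, ← hz,
        ← sub_eq_zero (a := t₁.realize (Sum.elim a xs)), ← hz]
      refine ⟨fun h0 => ?_, fun h0 => by rw [h0, map_zero]⟩
      by_contra hne
      exact hf z (by simp [hne]) h0
  | imp _ _ ih₁ ih₂ =>
    obtain ⟨F₁, h₁, k₁⟩ := ih₁
    obtain ⟨F₂, h₂, k₂⟩ := ih₂
    refine ⟨F₁ ∪ F₂, fun z hz => (Finset.mem_union.1 hz).elim (h₁ z) (h₂ z), fun f hf => ?_⟩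
    rw [Language.BoundedFormula.realize_imp, Language.BoundedFormula.realize_imp,
      k₁ f fun z hz => hf z (Finset.mem_union_left _ hz),
      k₂ f fun z hz => hf z (Finset.mem_union_right _ hz)]

theorem IsDiscriminatedBy.exists_not_realize (h : IsDiscriminatedBy R L₁ L₂) {α : Type*} {n : ℕ}
    {φ : (lieLanguage R).BoundedFormula α n} (hφ : φ.IsUniversal) (a : α → L₁) (xs : Fin n → L₁)
    (hn : ¬ φ.Realize a xs) : ∃ f : L₁ →ₗ⁅R⁆ L₂, ¬ φ.Realize (f ∘ a) (f ∘ xs) := by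
  induction hφ with
  | of_isQF hQ =>
    obtain ⟨F, hF, k⟩ := exists_finset_realize_iff (L₂ := L₂) hQ a xs
    obtain ⟨f, hf⟩ := h F hF
    exact ⟨f, fun hr => hn ((k f hf).1 hr)⟩
  | all _ ih =>
    rw [Language.BoundedFormula.realize_all] at hn
    push Not at hn
    obtain ⟨b, hb⟩ := hn
    -- The homomorphism is chosen at the quantifier-free core, once all witnesses are known.
    obtain ⟨f, hf⟩ := ih _ hb
    refine ⟨f, fun hr => hf ?_⟩
    rw [Fin.comp_snoc]
    exact Language.BoundedFormula.realize_all.1 hr (f b)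

theorem IsDiscriminatedBy.universalTheory_subset (h : IsDiscriminatedBy R L₁ L₂) :
    universalTheory R L₂ ⊆ universalTheory R L₁ := by
  rintro φ ⟨hU, hr⟩
  refine ⟨hU, ?_⟩
  by_contra hn
  obtain ⟨f, hf⟩ := h.exists_not_realize hU default default hn
  apply hf
  rw [Subsingleton.elim (f ∘ default) default, Subsingleton.elim (f ∘ default) default]
  exact hr

theorem universallyEquivalent_of_isDiscriminatedBy (h₁ : IsDiscriminatedBy R L₁ L₂)
    (h₂ : IsDiscriminatedBy R L₂ L₁) : UniversallyEquivalent R L₁ L₂ :=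
  h₂.universalTheory_subset.antisymm h₁.universalTheory_subset

end Discrimination

/-! ### Universal property of `M(X;G)` -/

/-- A homomorphism vanishing on an ideal factors through the quotient. -/
def LieIdeal.quotientLift {R : Type u} {L : Type v} {L' : Type w} [CommRing R]
    [LieRing L] [LieAlgebra R L] [LieRing L'] [LieAlgebra R L'] (I : LieIdeal R L)
    (f : L →ₗ⁅R⁆ L') (h : I ≤ f.ker) : L ⧸ I →ₗ⁅R⁆ L' where
  toLinearMap := Submodule.liftQ I.toSubmodule (f : L →ₗ[R] L') fun z hz =>
    LinearMap.mem_ker.2 (f.mem_ker.1 (h hz))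
  map_lie' := by
    intro x y
    obtain ⟨x, rfl⟩ := Submodule.Quotient.mk_surjective _ x
    obtain ⟨y, rfl⟩ := Submodule.Quotient.mk_surjective _ y
    exact f.map_lie x y

namespace PCMetabelian

section Basic

variable {R : Type u} {X : Type v} [CommRing R] {G : SimpleGraph X}

/-- The generator of `M(X;G)` attached to a vertex. -/
noncomputable def of (R : Type u) {X : Type v} [CommRing R] (G : SimpleGraph X) (x : X) :
    PCMetabelian R G :=
  LieSubmodule.Quotient.mk (freeMetabelianOf R x)

theorem lie_of_of_adj {x y : X} (h : G.Adj x y) : ⁅of R G x, of R G y⁆ = 0 := by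
  have : (LieSubmodule.Quotient.mk ⁅freeMetabelianOf R x, freeMetabelianOf R y⁆ :
      PCMetabelian R G) = 0 :=
    LieSubmodule.Quotient.mk_eq_zero'.2 (LieSubmodule.subset_lieSpan ⟨x, y, h, rfl⟩)
  exact this

theorem lie_lie_lie_lie (a b c d : PCMetabelian R G) : ⁅⁅a, b⁆, ⁅c, d⁆⁆ = 0 := by
  obtain ⟨a, rfl⟩ := Submodule.Quotient.mk_surjective _ a
  obtain ⟨b, rfl⟩ := Submodule.Quotient.mk_surjective _ b
  obtain ⟨c, rfl⟩ := Submodule.Quotient.mk_surjective _ c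
  obtain ⟨d, rfl⟩ := Submodule.Quotient.mk_surjective _ d
  obtain ⟨a, rfl⟩ := Submodule.Quotient.mk_surjective _ a
  obtain ⟨b, rfl⟩ := Submodule.Quotient.mk_surjective _ b
  obtain ⟨c, rfl⟩ := Submodule.Quotient.mk_surjective _ c
  obtain ⟨d, rfl⟩ := Submodule.Quotient.mk_surjective _ d
  have h : ⁅⁅a, b⁆, ⁅c, d⁆⁆ ∈ LieAlgebra.derivedSeries R (FreeLieAlgebra R X) 2 :=
    LieSubmodule.lie_mem_lie
      (LieSubmodule.lie_mem_lie (LieSubmodule.mem_top a) (LieSubmodule.mem_top b))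
      (LieSubmodule.lie_mem_lie (LieSubmodule.mem_top c) (LieSubmodule.mem_top d))
  have h' : (LieSubmodule.Quotient.mk ⁅⁅a, b⁆, ⁅c, d⁆⁆ : FreeMetabelianLieAlgebra R X) = 0 :=
    LieSubmodule.Quotient.mk_eq_zero'.2 h
  have h'' : (LieSubmodule.Quotient.mk (LieSubmodule.Quotient.mk ⁅⁅a, b⁆, ⁅c, d⁆⁆ :
      FreeMetabelianLieAlgebra R X) : PCMetabelian R G) = 0 := by rw [h']; rfl
  exact h''

section Lift

variable {L : Type w} [LieRing L] [LieAlgebra R L]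

theorem hom_ext {f g : PCMetabelian R G →ₗ⁅R⁆ L} (h : ∀ x, f (of R G x) = g (of R G x)) :
    f = g := by
  let q₁ : FreeLieAlgebra R X →ₗ⁅R⁆ FreeMetabelianLieAlgebra R X :=
    { (LieSubmodule.Quotient.mk' (LieAlgebra.derivedSeries R (FreeLieAlgebra R X) 2) :
        FreeLieAlgebra R X →ₗ[R] _) with map_lie' := rfl }
  let q₂ : FreeMetabelianLieAlgebra R X →ₗ⁅R⁆ PCMetabelian R G :=
    { (LieSubmodule.Quotient.mk' (commutationIdeal R G) :
        FreeMetabelianLieAlgebra R X →ₗ[R] _) with map_lie' := rfl }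
  have key : (f.comp q₂).comp q₁ = (g.comp q₂).comp q₁ := FreeLieAlgebra.hom_ext h
  ext z
  obtain ⟨z, rfl⟩ := Submodule.Quotient.mk_surjective _ z
  obtain ⟨z, rfl⟩ := Submodule.Quotient.mk_surjective _ z
  exact LieHom.congr_fun key z

theorem derivedSeries_two_le_ker (hL : ∀ a b c d : L, ⁅⁅a, b⁆, ⁅c, d⁆⁆ = 0) {L₀ : Type*}
    [LieRing L₀] [LieAlgebra R L₀] (f : L₀ →ₗ⁅R⁆ L) :
    LieAlgebra.derivedSeries R L₀ 2 ≤ f.ker := by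
  have hspan := LieAlgebra.coe_derivedSeries_one_eq R L₀
  rw [LieAlgebra.derivedSeries_def, LieAlgebra.derivedSeriesOfIdeal_succ, LieSubmodule.lie_le_iff]
  have aux : ∀ a b : L₀, ∀ n ∈ LieAlgebra.derivedSeries R L₀ 1, f ⁅⁅a, b⁆, n⁆ = 0 := by
    intro a b n hn
    have hn' : n ∈ Submodule.span R {⁅x, y⁆ | (x : L₀) (y : L₀)} := by
      rw [← hspan]; exact hn
    clear hn
    induction hn' using Submodule.span_induction with
    | mem n h =>
      obtain ⟨c, d, rfl⟩ := h
      rw [LieHom.map_lie, LieHom.map_lie, LieHom.map_lie, hL]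
    | zero => simp
    | add x y hx hy hx' hy' => rw [lie_add, map_add, hx', hy', add_zero]
    | smul r x hx hx' => rw [lie_smul, map_smul, hx', smul_zero]
  intro z hz n hn
  rw [LieHom.mem_ker]
  have hz' : z ∈ Submodule.span R {⁅x, y⁆ | (x : L₀) (y : L₀)} := by
    rw [← hspan]; exact hz
  clear hz
  induction hz' using Submodule.span_induction with
  | mem z h =>
    obtain ⟨c, d, rfl⟩ := h
    exact aux c d n hn
  | zero => simp
  | add x y hx hy hx' hy' => rw [add_lie, map_add, hx', hy', add_zero]
  | smul r x hx hx' => rw [smul_lie, map_smul, hx', smul_zero]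

/-- The homomorphism from `M(X;G)` to a metabelian Lie algebra given by the images of the
generators. -/
noncomputable def lift (hL : ∀ a b c d : L, ⁅⁅a, b⁆, ⁅c, d⁆⁆ = 0) (p : X → L)
    (hp : ∀ x y, G.Adj x y → ⁅p x, p y⁆ = 0) : PCMetabelian R G →ₗ⁅R⁆ L :=
  (commutationIdeal R G).quotientLift
    ((LieAlgebra.derivedSeries R (FreeLieAlgebra R X) 2).quotientLift (FreeLieAlgebra.lift R p)
      (derivedSeries_two_le_ker hL _)) <| by
    refine LieSubmodule.lieSpan_le.2 ?_
    rintro _ ⟨x, y, h, rfl⟩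
    refine LieHom.mem_ker.2 ?_
    have hof : ∀ x : X, (LieAlgebra.derivedSeries R (FreeLieAlgebra R X) 2).quotientLift
        (FreeLieAlgebra.lift R p) (derivedSeries_two_le_ker hL _) (freeMetabelianOf R x) = p x :=
      FreeLieAlgebra.lift_of_apply p
    rw [LieHom.map_lie, hof, hof, hp x y h]

@[simp]
theorem lift_of (hL : ∀ a b c d : L, ⁅⁅a, b⁆, ⁅c, d⁆⁆ = 0) (p : X → L)
    (hp : ∀ x y, G.Adj x y → ⁅p x, p y⁆ = 0) (x : X) : lift hL p hp (of R G x) = p x :=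
  FreeLieAlgebra.lift_of_apply p x

end Lift

end Basic

end PCMetabelian

/-! ### The two-dimensional test algebra -/

/-- The two-dimensional nonabelian Lie algebra over `K`: pairs `(a, b)` standing for
`a e + b f` with `[e, f] = f`. -/
@[ext]
structure AffineLie (K : Type u) where
  /-- The coefficient of `e`. -/
  fst : K
  /-- The coefficient of `f`. -/
  snd : K

namespace AffineLie

variable {R : Type u} {K : Type v} {K' : Type w} [CommRing R] [CommRing K] [Algebra R K]
  [CommRing K'] [Algebra R K']

instance : Zero (AffineLie K) := ⟨⟨0, 0⟩⟩
instance : Add (AffineLie K) := ⟨fun p q => ⟨p.1 + q.1, p.2 + q.2⟩⟩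
instance : Neg (AffineLie K) := ⟨fun p => ⟨-p.1, -p.2⟩⟩
instance : Sub (AffineLie K) := ⟨fun p q => ⟨p.1 - q.1, p.2 - q.2⟩⟩
instance : SMul R (AffineLie K) := ⟨fun r p => ⟨r • p.1, r • p.2⟩⟩
instance : Bracket (AffineLie K) (AffineLie K) := ⟨fun p q => ⟨0, p.1 * q.2 - p.2 * q.1⟩⟩

@[simp] theorem zero_fst : (0 : AffineLie K).fst = 0 := rfl
@[simp] theorem zero_snd : (0 : AffineLie K).snd = 0 := rfl
@[simp] theorem add_fst (p q : AffineLie K) : (p + q).fst = p.fst + q.fst := rfl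
@[simp] theorem add_snd (p q : AffineLie K) : (p + q).snd = p.snd + q.snd := rfl
@[simp] theorem neg_fst (p : AffineLie K) : (-p).fst = -p.fst := rfl
@[simp] theorem neg_snd (p : AffineLie K) : (-p).snd = -p.snd := rfl
@[simp] theorem sub_fst (p q : AffineLie K) : (p - q).fst = p.fst - q.fst := rfl
@[simp] theorem sub_snd (p q : AffineLie K) : (p - q).snd = p.snd - q.snd := rfl
@[simp] theorem smul_fst (r : R) (p : AffineLie K) : (r • p).fst = r • p.fst := rfl
@[simp] theorem smul_snd (r : R) (p : AffineLie K) : (r • p).snd = r • p.snd := rfl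
@[simp] theorem lie_fst (p q : AffineLie K) : ⁅p, q⁆.fst = 0 := rfl
@[simp] theorem lie_snd (p q : AffineLie K) : ⁅p, q⁆.snd = p.fst * q.snd - p.snd * q.fst := rfl

instance : AddCommGroup (AffineLie K) where
  add_assoc _ _ _ := by ext <;> simp [add_assoc]
  zero_add _ := by ext <;> simp
  add_zero _ := by ext <;> simp
  neg_add_cancel _ := by ext <;> simp
  add_comm _ _ := by ext <;> simp [add_comm]
  sub_eq_add_neg _ _ := by ext <;> simp [sub_eq_add_neg]
  nsmul := nsmulRec
  zsmul := zsmulRec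

instance : Module R (AffineLie K) where
  one_smul _ := by ext <;> simp
  mul_smul _ _ _ := by ext <;> simp [mul_smul]
  smul_zero _ := by ext <;> simp
  smul_add _ _ _ := by ext <;> simp
  add_smul _ _ _ := by ext <;> simp [add_smul]
  zero_smul _ := by ext <;> simp

instance : LieRing (AffineLie K) where
  add_lie _ _ _ := by ext <;> simp; ring
  lie_add _ _ _ := by ext <;> simp; ring
  lie_self _ := by ext <;> simp; ring
  leibniz_lie _ _ _ := by ext <;> simp; ring

instance : LieAlgebra R (AffineLie K) where
  lie_smul _ _ _ := by ext <;> simp [smul_sub]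

theorem lie_lie_lie_lie (a b c d : AffineLie K) : ⁅⁅a, b⁆, ⁅c, d⁆⁆ = 0 := by
  ext
  · rfl
  · rw [lie_snd, lie_fst, lie_fst, zero_mul, mul_zero, sub_zero, zero_snd]

theorem lie_eq_zero_iff {p q : AffineLie K} : ⁅p, q⁆ = 0 ↔ p.fst * q.snd = p.snd * q.fst := by
  rw [AffineLie.ext_iff]
  simp [sub_eq_zero]

/-- The second coordinate as a linear map. -/
def sndHom (R : Type u) (K : Type v) [CommRing R] [CommRing K] [Algebra R K] :
    AffineLie K →ₗ[R] K where
  toFun := snd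
  map_add' _ _ := rfl
  map_smul' _ _ := rfl

/-- The first coordinate as a linear map. -/
def fstHom (R : Type u) (K : Type v) [CommRing R] [CommRing K] [Algebra R K] :
    AffineLie K →ₗ[R] K where
  toFun := fst
  map_add' _ _ := rfl
  map_smul' _ _ := rfl

@[simp] theorem sndHom_apply (p : AffineLie K) : sndHom R K p = p.snd := rfl
@[simp] theorem fstHom_apply (p : AffineLie K) : fstHom R K p = p.fst := rfl

/-- Functoriality in the ring of coefficients. -/
def map (f : K →ₐ[R] K') : AffineLie K →ₗ⁅R⁆ AffineLie K' where
  toFun p := ⟨f p.1, f p.2⟩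
  map_add' _ _ := by ext <;> simp
  map_smul' _ _ := by ext <;> simp
  map_lie' := by intros; ext <;> simp

@[simp] theorem map_fst (f : K →ₐ[R] K') (p : AffineLie K) : (map f p).fst = f p.fst := rfl
@[simp] theorem map_snd (f : K →ₐ[R] K') (p : AffineLie K) : (map f p).snd = f p.snd := rfl

end AffineLie

/-! ### Commutator words and their span -/

namespace PCMetabelian

variable {R : Type u} {X : Type v} [CommRing R] {G : SimpleGraph X}

/-- The homomorphism from `M(X;G)` to the two-dimensional algebra sending the generators to a
family of elements that commute along the edges. -/
noncomputable def eval {K : Type w} [CommRing K] [Algebra R K] (p : X → AffineLie K)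
    (hp : ∀ x y, G.Adj x y → ⁅p x, p y⁆ = 0) : PCMetabelian R G →ₗ⁅R⁆ AffineLie K :=
  lift AffineLie.lie_lie_lie_lie p hp

@[simp]
theorem eval_of {K : Type w} [CommRing K] [Algebra R K] (p : X → AffineLie K)
    (hp : ∀ x y, G.Adj x y → ⁅p x, p y⁆ = 0) (x : X) : eval p hp (of R G x) = p x :=
  lift_of _ p hp x

/-- The left-normed commutator `[g k₁, [g k₂, …, [g i, g j]]]`, for `l = [k₁, k₂, …]`. -/
noncomputable def listWord (R : Type u) {X : Type v} [CommRing R] (G : SimpleGraph X)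
    (l : List X) (i j : X) : PCMetabelian R G :=
  l.foldr (fun k z => ⁅of R G k, z⁆) ⁅of R G i, of R G j⁆

theorem listWord_cons (k : X) (l : List X) (i j : X) :
    listWord R G (k :: l) i j = ⁅of R G k, listWord R G l i j⁆ := rfl

theorem exists_listWord_eq_lie (l : List X) (i j : X) :
    ∃ a b : PCMetabelian R G, listWord R G l i j = ⁅a, b⁆ := by
  cases l with
  | nil => exact ⟨_, _, rfl⟩
  | cons k l => exact ⟨_, _, rfl⟩

/-- By Jacobi the two sides differ by `⁅⁅a, b⁆, w⁆`, where `w` is itself a bracket, so metabelianity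
kills it. Hence only the multiset of outer letters matters. -/
theorem lie_lie_listWord_comm (a b : PCMetabelian R G) (l : List X) (i j : X) :
    ⁅a, ⁅b, listWord R G l i j⁆⁆ = ⁅b, ⁅a, listWord R G l i j⁆⁆ := by
  obtain ⟨c, d, h⟩ := exists_listWord_eq_lie (R := R) (G := G) l i j
  rw [leibniz_lie a b, h, lie_lie_lie_lie, zero_add]

theorem listWord_perm {l l' : List X} (h : l.Perm l') (i j : X) :
    listWord R G l i j = listWord R G l' i j := by
  induction h with
  | nil => rfl
  | cons x _ ih => rw [listWord_cons, ih, listWord_cons]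
  | swap x y l => exact lie_lie_listWord_comm _ _ _ _ _
  | trans _ _ ih₁ ih₂ => exact ih₁.trans ih₂

theorem listWord_self (l : List X) (i : X) : listWord R G l i i = 0 := by
  induction l with
  | nil => exact lie_self _
  | cons k l ih => rw [listWord_cons, ih, lie_zero]

theorem listWord_adj (l : List X) {i j : X} (h : G.Adj i j) : listWord R G l i j = 0 := by
  induction l with
  | nil => exact lie_of_of_adj h
  | cons k l ih => rw [listWord_cons, ih, lie_zero]

theorem listWord_swap (l : List X) (i j : X) :
    listWord R G l i j = - listWord R G l j i := by
  induction l with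
  | nil => exact (lie_skew _ _).symm
  | cons k l ih => rw [listWord_cons, ih, lie_neg, listWord_cons]

theorem listWord_jacobi (l : List X) (i j k : X) :
    listWord R G (k :: l) i j + listWord R G (i :: l) j k + listWord R G (j :: l) k i = 0 := by
  induction l with
  | nil =>
    have := lie_jacobi (of R G k) (of R G i) (of R G j)
    exact this
  | cons m l ih =>
    rw [listWord_perm (List.Perm.swap m k l), listWord_perm (List.Perm.swap m i l),
      listWord_perm (List.Perm.swap m j l), listWord_cons, listWord_cons m, listWord_cons m,
      ← lie_add, ← lie_add, ih, lie_zero]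

/-- The commutator `[g k₁, [g k₂, …, [g i, g j]]]`, for the multiset `s = {k₁, k₂, …}`. -/
noncomputable def word (R : Type u) {X : Type v} [CommRing R] (G : SimpleGraph X)
    (s : Multiset X) (i j : X) : PCMetabelian R G :=
  listWord R G s.toList i j

theorem word_coe (l : List X) (i j : X) : word R G (l : Multiset X) i j = listWord R G l i j :=
  listWord_perm (Multiset.coe_eq_coe.1 (Multiset.coe_toList _)) i j

theorem word_jacobi (s : Multiset X) (i j k : X) :
    word R G (k ::ₘ s) i j + word R G (i ::ₘ s) j k + word R G (j ::ₘ s) k i = 0 := by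
  induction s using Quotient.inductionOn with
  | h l =>
    have := listWord_jacobi (R := R) (G := G) l i j k
    simp only [← word_coe, ← Multiset.cons_coe] at this
    exact this

theorem word_self (s : Multiset X) (i : X) : word R G s i i = 0 := listWord_self _ _

theorem word_adj (s : Multiset X) {i j : X} (h : G.Adj i j) : word R G s i j = 0 :=
  listWord_adj _ h

theorem word_swap (s : Multiset X) (i j : X) : word R G s i j = - word R G s j i :=
  listWord_swap _ _ _

/-- A bracket lies on the line of `f`, where a point acts by multiplication with its first
coordinate; the innermost bracket is a determinant. -/
theorem eval_listWord {K : Type w} [CommRing K] [Algebra R K] (p : X → AffineLie K)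
    (hp : ∀ x y, G.Adj x y → ⁅p x, p y⁆ = 0) (l : List X) (i j : X) :
    eval p hp (listWord R G l i j) =
      ⟨0, (l.map fun k => (p k).fst).prod * ((p i).fst * (p j).snd - (p i).snd * (p j).fst)⟩ := by
  induction l with
  | nil =>
    rw [listWord, List.foldr_nil, LieHom.map_lie, eval_of, eval_of]
    ext <;> simp
  | cons k l ih =>
    rw [listWord_cons, LieHom.map_lie, ih, eval_of]
    ext <;> simp [mul_assoc]

theorem eval_word {K : Type w} [CommRing K] [Algebra R K] (p : X → AffineLie K)
    (hp : ∀ x y, G.Adj x y → ⁅p x, p y⁆ = 0) (s : Multiset X) (i j : X) :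
    eval p hp (word R G s i j) =
      ⟨0, (s.map fun k => (p k).fst).prod * ((p i).fst * (p j).snd - (p i).snd * (p j).fst)⟩ := by
  induction s using Quotient.inductionOn with
  | h l =>
    change eval p hp (word R G (l : Multiset X) i j) = _
    rw [word_coe, eval_listWord]
    rfl

/-- The span of the commutators of generators. -/
noncomputable def wordSpan (R : Type u) {X : Type v} [CommRing R] (G : SimpleGraph X) :
    Submodule R (PCMetabelian R G) :=
  Submodule.span R (Set.range fun t : Multiset X × X × X => word R G t.1 t.2.1 t.2.2)

theorem listWord_mem_wordSpan (l : List X) (i j : X) : listWord R G l i j ∈ wordSpan R G := by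
  rw [← word_coe]
  exact Submodule.subset_span ⟨((l : Multiset X), i, j), rfl⟩

theorem lie_of_mem_wordSpan (k : X) {z : PCMetabelian R G} (hz : z ∈ wordSpan R G) :
    ⁅of R G k, z⁆ ∈ wordSpan R G := by
  induction hz using Submodule.span_induction with
  | mem z h =>
    obtain ⟨t, rfl⟩ := h
    exact listWord_mem_wordSpan (k :: t.1.toList) t.2.1 t.2.2
  | zero => rw [lie_zero]; exact Submodule.zero_mem _
  | add x y _ _ hx hy => rw [lie_add]; exact Submodule.add_mem _ hx hy
  | smul r x _ hx => rw [lie_smul]; exact Submodule.smul_mem _ _ hx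

theorem lie_eq_zero_of_mem_wordSpan {z t : PCMetabelian R G} (hz : z ∈ wordSpan R G)
    (ht : t ∈ wordSpan R G) : ⁅z, t⁆ = 0 := by
  induction hz using Submodule.span_induction with
  | mem z h =>
    obtain ⟨s, rfl⟩ := h
    induction ht using Submodule.span_induction with
    | mem t h =>
      obtain ⟨s', rfl⟩ := h
      obtain ⟨a, b, h⟩ := exists_listWord_eq_lie (R := R) (G := G) s.1.toList s.2.1 s.2.2
      obtain ⟨a', b', h'⟩ := exists_listWord_eq_lie (R := R) (G := G) s'.1.toList s'.2.1 s'.2.2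
      simp only [word, h, h', lie_lie_lie_lie]
    | zero => rw [lie_zero]
    | add x y _ _ hx hy => rw [lie_add, hx, hy, add_zero]
    | smul r x _ hx => rw [lie_smul, hx, smul_zero]
  | zero => rw [zero_lie]
  | add x y _ _ hx hy => rw [add_lie, hx, hy, add_zero]
  | smul r x _ hx => rw [smul_lie, hx, smul_zero]

/-- The span of the generators. -/
noncomputable def linearSpan (R : Type u) {X : Type v} [CommRing R] (G : SimpleGraph X) :
    Submodule R (PCMetabelian R G) :=
  Submodule.span R (Set.range (of R G))

theorem lie_mem_wordSpan_of_mem_linearSpan {z t : PCMetabelian R G} (hz : z ∈ linearSpan R G)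
    (ht : t ∈ wordSpan R G) : ⁅z, t⁆ ∈ wordSpan R G := by
  induction hz using Submodule.span_induction with
  | mem z h =>
    obtain ⟨k, rfl⟩ := h
    exact lie_of_mem_wordSpan k ht
  | zero => rw [zero_lie]; exact Submodule.zero_mem _
  | add x y _ _ hx hy => rw [add_lie]; exact Submodule.add_mem _ hx hy
  | smul r x _ hx => rw [smul_lie]; exact Submodule.smul_mem _ _ hx

theorem lie_mem_wordSpan_of_mem_linearSpan_of_mem_linearSpan {z t : PCMetabelian R G}
    (hz : z ∈ linearSpan R G) (ht : t ∈ linearSpan R G) : ⁅z, t⁆ ∈ wordSpan R G := by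
  induction hz using Submodule.span_induction with
  | mem z h =>
    obtain ⟨k, rfl⟩ := h
    induction ht using Submodule.span_induction with
    | mem t h =>
      obtain ⟨j, rfl⟩ := h
      exact listWord_mem_wordSpan [] k j
    | zero => rw [lie_zero]; exact Submodule.zero_mem _
    | add x y _ _ hx hy => rw [lie_add]; exact Submodule.add_mem _ hx hy
    | smul r x _ hx => rw [lie_smul]; exact Submodule.smul_mem _ _ hx
  | zero => rw [zero_lie]; exact Submodule.zero_mem _
  | add x y _ _ hx hy => rw [add_lie]; exact Submodule.add_mem _ hx hy
  | smul r x _ hx => rw [smul_lie]; exact Submodule.smul_mem _ _ hx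

theorem lie_mem_wordSpan {z t : PCMetabelian R G} (hz : z ∈ linearSpan R G ⊔ wordSpan R G)
    (ht : t ∈ linearSpan R G ⊔ wordSpan R G) : ⁅z, t⁆ ∈ wordSpan R G := by
  obtain ⟨z₁, hz₁, z₂, hz₂, rfl⟩ := Submodule.mem_sup.1 hz
  obtain ⟨t₁, ht₁, t₂, ht₂, rfl⟩ := Submodule.mem_sup.1 ht
  rw [add_lie, lie_add, lie_add, lie_eq_zero_of_mem_wordSpan hz₂ ht₂, add_zero,
    ← lie_skew z₂ t₁]
  exact Submodule.add_mem _
    (Submodule.add_mem _ (lie_mem_wordSpan_of_mem_linearSpan_of_mem_linearSpan hz₁ ht₁)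
      (lie_mem_wordSpan_of_mem_linearSpan hz₁ ht₂))
    (Submodule.neg_mem _ (lie_mem_wordSpan_of_mem_linearSpan ht₁ hz₂))

/-- The generators lift to a homomorphism into `S`; followed by the inclusion it fixes them, so it
is the identity. -/
theorem mem_lieSubalgebra_of_of_mem {S : LieSubalgebra R (PCMetabelian R G)}
    (hS : ∀ x, of R G x ∈ S) (z : PCMetabelian R G) : z ∈ S := by
  let f : PCMetabelian R G →ₗ⁅R⁆ S :=
    lift (fun a b c d => Subtype.ext (lie_lie_lie_lie (a : PCMetabelian R G) b c d))
      (fun x => ⟨of R G x, hS x⟩) fun x y h => Subtype.ext (lie_of_of_adj h)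
  have hf : S.incl.comp f = LieHom.id := hom_ext fun x => by simp [f]
  have : S.incl (f z) = z := LieHom.congr_fun hf z
  rw [← this]
  exact (f z).2

theorem lie_eq_zero_of_lie_of_eq_zero {z : PCMetabelian R G} (hz : ∀ x, ⁅z, of R G x⁆ = 0)
    (t : PCMetabelian R G) : ⁅z, t⁆ = 0 :=
  mem_lieSubalgebra_of_of_mem (S := { LinearMap.ker (LieAlgebra.ad R (PCMetabelian R G) z) with
    lie_mem' := fun {a b} (ha : ⁅z, a⁆ = 0) (hb : ⁅z, b⁆ = 0) =>
      show ⁅z, ⁅a, b⁆⁆ = 0 by rw [leibniz_lie, ha, hb, zero_lie, lie_zero, add_zero] }) hz t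

theorem linearSpan_sup_wordSpan : linearSpan R G ⊔ wordSpan R G = ⊤ :=
  eq_top_iff.2 fun z _ => mem_lieSubalgebra_of_of_mem
    (S := { linearSpan R G ⊔ wordSpan R G with
      lie_mem' := fun hz ht => Submodule.mem_sup_right (lie_mem_wordSpan hz ht) })
    (fun x => Submodule.mem_sup_left (Submodule.subset_span ⟨x, rfl⟩)) z

end PCMetabelian

/-! ### Separation of elements by points of the test algebra -/

namespace PCMetabelian

variable {R : Type u} {X : Type v} [CommRing R] {G : SimpleGraph X}

theorem map_eval {K : Type*} {K' : Type*} [CommRing K] [Algebra R K] [CommRing K'] [Algebra R K']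
    (f : K →ₐ[R] K') (p : X → AffineLie K) (hp : ∀ x y, G.Adj x y → ⁅p x, p y⁆ = 0)
    (q : X → AffineLie K') (hq : ∀ x y, G.Adj x y → ⁅q x, q y⁆ = 0)
    (h : ∀ x, AffineLie.map f (p x) = q x) (z : PCMetabelian R G) :
    AffineLie.map f (eval p hp z) = eval q hq z := by
  have : (AffineLie.map f).comp (eval p hp) = eval (G := G) q hq :=
    hom_ext fun x => by simp [h]
  exact LieHom.congr_fun this z

theorem fst_eq_zero_of_mem_wordSpan {K : Type*} [CommRing K] [Algebra R K]
    (f : PCMetabelian R G →ₗ⁅R⁆ AffineLie K) {z : PCMetabelian R G} (hz : z ∈ wordSpan R G) :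
    (f z).fst = 0 := by
  induction hz using Submodule.span_induction with
  | mem z h =>
    obtain ⟨t, rfl⟩ := h
    obtain ⟨a, b, h⟩ := exists_listWord_eq_lie (R := R) (G := G) t.1.toList t.2.1 t.2.2
    simp only [word, h, LieHom.map_lie, AffineLie.lie_fst]
  | zero => rw [map_zero, AffineLie.zero_fst]
  | add x y _ _ hx hy => rw [map_add, AffineLie.add_fst, hx, hy, add_zero]
  | smul r x _ hx => rw [map_smul, AffineLie.smul_fst, hx, smul_zero]

section Coord

open Classical in
/-- The point with coordinates `e` at `i` and `0` elsewhere. -/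
noncomputable def coordPoint (R : Type u) {X : Type v} [CommRing R] (i x : X) : AffineLie R :=
  ⟨if x = i then 1 else 0, 0⟩

theorem lie_coordPoint (i x y : X) : ⁅coordPoint R i x, coordPoint R i y⁆ = 0 := by
  rw [AffineLie.lie_eq_zero_iff]
  simp [coordPoint]

/-- The coefficient of the generator `i` in the linear part. -/
noncomputable def coord (R : Type u) {X : Type v} [CommRing R] (G : SimpleGraph X) (i : X) :
    PCMetabelian R G →ₗ[R] R :=
  AffineLie.fstHom R R ∘ₗ
    (eval (R := R) (G := G) (coordPoint R i) fun x y _ => lie_coordPoint i x y).toLinearMap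

theorem coord_apply (i : X) (z : PCMetabelian R G) :
    coord R G i z = (eval (coordPoint R i) (fun x y _ => lie_coordPoint i x y) z).fst := rfl

open Classical in
theorem coord_of (i x : X) : coord R G i (of R G x) = if x = i then 1 else 0 := by
  rw [coord_apply, eval_of, coordPoint]

theorem coord_eq_zero_of_mem_wordSpan (i : X) {z : PCMetabelian R G} (hz : z ∈ wordSpan R G) :
    coord R G i z = 0 :=
  fst_eq_zero_of_mem_wordSpan _ hz

theorem mem_wordSpan_of_coord_eq_zero {z : PCMetabelian R G} (hz : ∀ i, coord R G i z = 0) :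
    z ∈ wordSpan R G := by
  classical
  have h : z ∈ linearSpan R G ⊔ wordSpan R G := by rw [linearSpan_sup_wordSpan]; trivial
  obtain ⟨t, ht, d, hd, rfl⟩ := Submodule.mem_sup.1 h
  obtain ⟨c, rfl⟩ := Finsupp.mem_span_range_iff_exists_finsupp.1 ht
  have hc : c = 0 := by
    ext i
    have := hz i
    rw [map_add, coord_eq_zero_of_mem_wordSpan i hd, add_zero, Finsupp.sum, map_sum] at this
    simpa [coord_of] using this
  rwa [hc, Finsupp.sum_zero_index, zero_add]

end Coord

section NormalWord

/-- Vertices in the support of `m` that are adjacent in `G`. -/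
def SupportAdj (G : SimpleGraph X) (m : Multiset X) (i j : X) : Prop :=
  i ∈ m ∧ j ∈ m ∧ G.Adj i j

/-- The components of the subgraph induced on the support of `m`; the vertices outside the
support are components of their own. -/
abbrev SupportComponent (G : SimpleGraph X) (m : Multiset X) : Type v := Quot (SupportAdj G m)

variable [DecidableEq X]

/-- For `i ∈ m`, the commutator of multidegree `m` that ends in `[i, b]`. -/
noncomputable def normalWord (R : Type u) {X : Type v} [CommRing R] [DecidableEq X]
    (G : SimpleGraph X) (b : X) (m : Multiset X) (i : X) : PCMetabelian R G :=
  if i ∈ m then word R G ((m.erase i).erase b) i b else 0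

theorem normalWord_self (b : X) (m : Multiset X) : normalWord R G b m b = 0 := by
  rw [normalWord, word_self, ite_self]

/-- The Jacobi identity brings a chosen letter `b` of the multidegree into the innermost bracket. -/
theorem word_eq_normalWord_sub {b : X} (s : Multiset X) (i j : X) (hb : b ∈ i ::ₘ j ::ₘ s) :
    word R G s i j =
      normalWord R G b (i ::ₘ j ::ₘ s) i - normalWord R G b (i ::ₘ j ::ₘ s) j := by
  by_cases hij : i = j
  · subst hij
    rw [word_self, sub_self]
  have hj : (i ::ₘ j ::ₘ s).erase j = i ::ₘ s := by
    rw [Multiset.cons_swap, Multiset.erase_cons_head]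
  rw [normalWord, if_pos (by simp), normalWord, if_pos (by simp), Multiset.erase_cons_head, hj]
  by_cases hbi : b = i
  · subst hbi
    rw [word_self, Multiset.erase_cons_head, word_swap, zero_sub]
  by_cases hbj : b = j
  · subst hbj
    rw [word_self, Multiset.erase_cons_head, sub_zero]
  have hbs : b ∈ s := by simpa [hbi, hbj] using hb
  obtain ⟨s, rfl⟩ := Multiset.exists_cons_of_mem hbs
  rw [Multiset.cons_swap j, Multiset.erase_cons_head, Multiset.cons_swap i,
    Multiset.erase_cons_head, word_swap _ i b, eq_sub_iff_add_eq, eq_neg_iff_add_eq_zero]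
  exact word_jacobi s i j b

/-- The difference of the two normal words is a word ending in `[i, j]`, which vanishes along an
edge. Normal words thus depend only on the component of `i` in the support. -/
theorem normalWord_eq_of_supportAdj {b : X} {m : Multiset X} (hb : b ∈ m) {i j : X}
    (h : SupportAdj G m i j) : normalWord R G b m i = normalWord R G b m j := by
  obtain ⟨hi, hj, hij⟩ := h
  obtain ⟨s, rfl⟩ := Multiset.exists_cons_of_mem hi
  have hjs : j ∈ s := by simpa [hij.ne.symm] using hj
  obtain ⟨s, rfl⟩ := Multiset.exists_cons_of_mem hjs
  rw [← sub_eq_zero, ← word_eq_normalWord_sub s i j hb, word_adj s hij]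

theorem normalWord_eq_of_component_eq {b : X} {m : Multiset X} (hb : b ∈ m) {i j : X}
    (h : (Quot.mk _ i : SupportComponent G m) = Quot.mk _ j) :
    normalWord R G b m i = normalWord R G b m j :=
  congrArg (Quot.lift (normalWord R G b m) fun _ _ h => normalWord_eq_of_supportAdj hb h) h

theorem wordSpan_le_span_normalWord (b : Multiset X → X) (hb : ∀ m, m ≠ 0 → b m ∈ m) :
    wordSpan R G ≤
      Submodule.span R (Set.range fun t : Multiset X × X => normalWord R G (b t.1) t.1 t.2) := by
  refine Submodule.span_le.2 ?_
  rintro _ ⟨⟨s, i, j⟩, rfl⟩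
  simp only [SetLike.mem_coe]
  rw [word_eq_normalWord_sub s i j (hb _ (Multiset.cons_ne_zero))]
  exact Submodule.sub_mem _ (Submodule.subset_span ⟨(_, i), rfl⟩)
    (Submodule.subset_span ⟨(_, j), rfl⟩)

end NormalWord

section Separation

open MvPolynomial

variable [DecidableEq X]

open Classical in
/-- The generic point attached to the support of `m` and a component `κ` of it. -/
noncomputable def componentPoint (R : Type u) {X : Type v} [CommRing R] {G : SimpleGraph X}
    (m : Multiset X) (κ : SupportComponent G m) (x : X) : AffineLie (MvPolynomial X R) :=
  ⟨if x ∈ m then MvPolynomial.X x else 0,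
    (if x ∈ m then MvPolynomial.X x else 0) * if (Quot.mk _ x : SupportComponent G m) = κ then 1 else 0⟩

/-- Adjacent vertices of the support share a component, so their points are multiples of the same
vector; off the support the point is zero. -/
theorem lie_componentPoint (m : Multiset X) (κ : SupportComponent G m) (x y : X)
    (h : G.Adj x y) : ⁅componentPoint R m κ x, componentPoint R m κ y⁆ = 0 := by
  classical
  rw [AffineLie.lie_eq_zero_iff]
  by_cases hx : x ∈ m
  · by_cases hy : y ∈ m
    · have : (Quot.mk _ x : SupportComponent G m) = Quot.mk _ y := Quot.sound ⟨hx, hy, h⟩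
      have e : (if (Quot.mk _ x : SupportComponent G m) = κ then (1 : MvPolynomial X R) else 0) =
          if (Quot.mk _ y : SupportComponent G m) = κ then 1 else 0 := by rw [this]
      simp only [componentPoint]
      rw [e]
      ring
    · simp [componentPoint, hy]
  · simp [componentPoint, hx]

theorem prod_map_X (m : Multiset X) :
    (m.map (MvPolynomial.X : X → MvPolynomial X R)).prod =
      monomial (Multiset.toFinsupp m) 1 := by
  induction m using Multiset.induction with
  | empty => simp
  | cons a s ih =>
    rw [Multiset.map_cons, Multiset.prod_cons, ih, ← Multiset.singleton_add, map_add,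
      Multiset.toFinsupp_singleton, MvPolynomial.X, monomial_mul, one_mul]

theorem coeff_prod_map (m m' : Multiset X) :
    coeff (Multiset.toFinsupp m)
      (m'.map fun x => if x ∈ m then (MvPolynomial.X x : MvPolynomial X R) else 0).prod =
      if m' = m then 1 else 0 := by
  classical
  by_cases h : ∀ x ∈ m', x ∈ m
  · rw [Multiset.map_congr rfl (fun x hx => if_pos (h x hx)), prod_map_X, coeff_monomial]
    simp
  · push Not at h
    obtain ⟨x, hx, hxm⟩ := h
    rw [Multiset.prod_eq_zero (Multiset.mem_map.2 ⟨x, hx, if_neg hxm⟩), coeff_zero, if_neg]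
    rintro rfl
    exact hxm hx

/-- The coefficient of the monomial `m` in the second coordinate at `componentPoint m κ`. -/
noncomputable def componentCoeff (R : Type u) {X : Type v} [CommRing R] [DecidableEq X]
    (G : SimpleGraph X) (m : Multiset X) (κ : SupportComponent G m) : PCMetabelian R G →ₗ[R] R :=
  lcoeff R (Multiset.toFinsupp m) ∘ₗ AffineLie.sndHom R (MvPolynomial X R) ∘ₗ
    (eval (R := R) (componentPoint R m κ) (lie_componentPoint m κ)).toLinearMap

theorem componentCoeff_apply (m : Multiset X) (κ : SupportComponent G m) (z : PCMetabelian R G) :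
    componentCoeff R G m κ z = coeff (Multiset.toFinsupp m)
      (eval (componentPoint R m κ) (lie_componentPoint m κ) z).snd := rfl

open Classical in
theorem componentCoeff_normalWord {m m' : Multiset X} (κ : SupportComponent G m) {b : X}
    (hb : m' ≠ 0 → b ∈ m') (i : X) :
    componentCoeff R G m κ (normalWord R G b m' i) =
      if m' = m ∧ i ∈ m then
        (if (Quot.mk _ b : SupportComponent G m) = κ then 1 else 0) -
          (if (Quot.mk _ i : SupportComponent G m) = κ then 1 else 0) else 0 := by
  by_cases hi : i ∈ m'
  · have hb' : b ∈ m' := hb fun h => by simp [h] at hi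
    have key : (eval (componentPoint R m κ) (lie_componentPoint m κ)
        (normalWord R G b m' i)).snd =
        C ((if (Quot.mk _ b : SupportComponent G m) = κ then 1 else 0) -
          (if (Quot.mk _ i : SupportComponent G m) = κ then 1 else 0)) *
          (m'.map fun x => if x ∈ m then (MvPolynomial.X x : MvPolynomial X R) else 0).prod := by
      by_cases hbi : b = i
      · subst hbi
        rw [normalWord_self, map_zero]
        simp
      · have hb'' : b ∈ m'.erase i := (Multiset.mem_erase_of_ne hbi).2 hb'
        -- The determinant of the innermost bracket supplies the variables of `i` and `b`,
        -- completing the monomial of `m'`.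
        rw [normalWord, if_pos hi, eval_word, ← Multiset.prod_map_erase hi,
          ← Multiset.prod_map_erase hb'']
        simp only [componentPoint]
        rw [map_sub, apply_ite C, apply_ite C, map_one, map_zero]
        ring_nf
    rw [componentCoeff_apply, key, coeff_C_mul, coeff_prod_map]
    by_cases hm : m' = m
    · subst hm
      simp [hi]
    · simp [hm]
  · rw [normalWord, if_neg hi, map_zero, if_neg]
    rintro ⟨rfl, h⟩
    exact hi h

/-- Expand `z` in normal words and group them by multidegree and component. The component of the
base letter contributes nothing; for any other with a nonzero word, `componentCoeff` returns minus
the sum of its coefficients, so each group vanishes. -/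
theorem eq_zero_of_componentCoeff_eq_zero [Fintype X] {z : PCMetabelian R G}
    (hz : z ∈ wordSpan R G) (h : ∀ m κ, componentCoeff R G m κ z = 0) : z = 0 := by
  classical
  cases isEmpty_or_nonempty X with
  | inl hX =>
    exact LieHom.congr_fun (hom_ext (f := LieHom.id) (g := 0) isEmptyElim) z
  | inr hX =>
  -- The empty multiset has no letter to serve as base; its value is arbitrary, since its normal
  -- words are zero.
  have hb : ∀ m : Multiset X, ∃ b, m ≠ 0 → b ∈ m := fun m => by
    by_cases hm : m = 0
    · exact ⟨Classical.arbitrary X, fun h => absurd hm h⟩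
    · obtain ⟨b, hb⟩ := Multiset.exists_mem_of_ne_zero hm
      exact ⟨b, fun _ => hb⟩
  choose b hb using hb
  obtain ⟨c, hc⟩ := Finsupp.mem_span_range_iff_exists_finsupp.1
    (wordSpan_le_span_normalWord b hb hz)
  have hsum : z = ∑ m ∈ c.support.image Prod.fst, ∑ i,
      c (m, i) • normalWord R G (b m) m i := by
    rw [← hc, Finsupp.sum_of_support_subset c (s := c.support.image Prod.fst ×ˢ Finset.univ),
      Finset.sum_product]
    · intro t ht
      exact Finset.mem_product.2 ⟨Finset.mem_image_of_mem _ ht, Finset.mem_univ _⟩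
    · simp
  rw [hsum]
  refine Finset.sum_eq_zero fun m hm => ?_
  by_cases hm0 : m = 0
  · refine Finset.sum_eq_zero fun i _ => ?_
    rw [normalWord, if_neg (by simp [hm0]), smul_zero]
  have hbm := hb m hm0
  rw [← Finset.sum_fiberwise_of_maps_to (t := Finset.univ.image fun i =>
    (Quot.mk _ i : SupportComponent G m)) (fun i _ => Finset.mem_image_of_mem _ (Finset.mem_univ i))]
  refine Finset.sum_eq_zero fun κ hκ => ?_
  obtain ⟨i₀, -, rfl⟩ := Finset.mem_image.1 hκ
  have hconst : ∀ i ∈ Finset.univ.filter (fun i => (Quot.mk _ i : SupportComponent G m) =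
      Quot.mk _ i₀), c (m, i) • normalWord R G (b m) m i =
        c (m, i) • normalWord R G (b m) m i₀ := fun i hi => by
    rw [normalWord_eq_of_component_eq hbm (Finset.mem_filter.1 hi).2]
  rw [Finset.sum_congr rfl hconst, ← Finset.sum_smul]
  by_cases h0 : normalWord R G (b m) m i₀ = 0
  · rw [h0, smul_zero]
  have hmem : ∀ i, (Quot.mk _ i : SupportComponent G m) = Quot.mk _ i₀ → i ∈ m := by
    intro i hi
    by_contra him
    apply h0
    rw [← normalWord_eq_of_component_eq hbm hi, normalWord, if_neg him]
  have hbκ : (Quot.mk _ (b m) : SupportComponent G m) ≠ Quot.mk _ i₀ := by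
    intro hi
    apply h0
    rw [← normalWord_eq_of_component_eq hbm hi, normalWord_self]
  have hz0 := h m (Quot.mk _ i₀)
  rw [hsum, map_sum, Finset.sum_eq_single_of_mem m hm, map_sum] at hz0
  · simp only [map_smul, componentCoeff_normalWord _ (hb _), if_neg hbκ, smul_eq_mul, true_and]
      at hz0
    convert zero_smul R _ using 2
    rw [Finset.sum_filter, ← neg_eq_zero, ← Finset.sum_neg_distrib]
    refine (Finset.sum_congr rfl fun i _ => ?_).trans hz0
    by_cases hi : (Quot.mk _ i : SupportComponent G m) = Quot.mk _ i₀
    · simp [hi, hmem i hi]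
    · simp [hi]
  · intro m' _ hm'
    rw [map_sum]
    refine Finset.sum_eq_zero fun i _ => ?_
    rw [map_smul, componentCoeff_normalWord _ (hb _), if_neg (fun h => hm' h.1), smul_zero]

end Separation

/-- The homomorphisms to two-dimensional Lie algebras separate the elements of `M(X;G)`. -/
theorem exists_eval_ne_zero [Finite X] {z : PCMetabelian R G} (hz : z ≠ 0) :
    ∃ (p : X → AffineLie (MvPolynomial X R)) (hp : ∀ x y, G.Adj x y → ⁅p x, p y⁆ = 0),
      eval p hp z ≠ 0 := by
  classical
  have := Fintype.ofFinite X
  by_contra! h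
  apply hz
  refine eq_zero_of_componentCoeff_eq_zero (mem_wordSpan_of_coord_eq_zero fun i => ?_) fun m κ => ?_
  -- Linear coordinates come from points over `R`, viewed as constant polynomials.
  · let f : R →ₐ[R] MvPolynomial X R := Algebra.ofId R _
    have hp : ∀ x y, G.Adj x y → ⁅AffineLie.map f (coordPoint R i x),
        AffineLie.map f (coordPoint R i y)⁆ = 0 := fun x y _ => by
      rw [← LieHom.map_lie, lie_coordPoint, map_zero]
    have h0 := h _ hp
    rw [← map_eval f _ (fun x y _ => lie_coordPoint i x y) _ hp fun x => rfl] at h0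
    have := congrArg AffineLie.fst h0
    rw [AffineLie.map_fst, AffineLie.zero_fst] at this
    exact MvPolynomial.C_injective X R (this.trans (map_zero _).symm)
  · rw [componentCoeff_apply, h, AffineLie.zero_snd, MvPolynomial.coeff_zero]

end PCMetabelian

/-! ### Twins and the collapse of their classes -/

section Twins

variable {X : Type v} {Y : Type w} {G : SimpleGraph X} {G' : SimpleGraph Y}

theorem mem_perp_iff {x y : X} : y ∈ perp G x ↔ G.Adj x y ∨ x = y :=
  SimpleGraph.edist_le_one_iff_adj_or_eq

theorem mem_perp_comm {x y : X} : y ∈ perp G x ↔ x ∈ perp G y := by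
  rw [mem_perp_iff, mem_perp_iff, G.adj_comm, eq_comm]

theorem PerpEquiv.mem_perp_iff_mem_perp {x x' y y' : X} (hx : PerpEquiv G x x')
    (hy : PerpEquiv G y y') : y ∈ perp G x ↔ y' ∈ perp G x' := by
  rw [hx, mem_perp_comm, hy, mem_perp_comm]

theorem SimpleGraph.Embedding.mem_perp_iff (ι : G' ↪g G) {x y : Y} :
    ι y ∈ perp G (ι x) ↔ y ∈ perp G' x := by
  rw [_root_.mem_perp_iff, _root_.mem_perp_iff, ι.map_adj_iff, ι.injective.eq_iff]

end Twins

/-- The bracket is the determinant of the coordinate vectors, so commuting with a nonzero vector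
over a field means proportionality. -/
theorem AffineLie.exists_smul_eq {K : Type u} [Field K] {p q : AffineLie K} (hp : p ≠ 0)
    (h : ⁅p, q⁆ = 0) : ∃ c : K, q = c • p := by
  rw [AffineLie.lie_eq_zero_iff] at h
  by_cases h1 : p.fst = 0
  · have h2 : p.snd ≠ 0 := fun h2 => hp (AffineLie.ext h1 h2)
    have h3 : q.fst = 0 := by
      rw [h1, zero_mul] at h
      exact (mul_eq_zero.1 h.symm).resolve_left h2
    refine ⟨q.snd / p.snd, AffineLie.ext ?_ ?_⟩
    · simp [h1, h3]
    · simp [h2]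
  · refine ⟨q.fst / p.fst, AffineLie.ext ?_ ?_⟩
    · simp [h1]
    · simp only [smul_snd, smul_eq_mul]
      field_simp
      linear_combination h

namespace PCMetabelian

variable {R : Type u} {X : Type v} {Y : Type w} [CommRing R] {G : SimpleGraph X}
  {G' : SimpleGraph Y}

section Embedding

/-- Sending the vertices outside the image to zero respects the relations and gives a left inverse.
-/
theorem isDiscriminatedBy_of_embedding (ι : G' ↪g G) :
    IsDiscriminatedBy R (PCMetabelian R G') (PCMetabelian R G) := by
  classical
  let f : PCMetabelian R G' →ₗ⁅R⁆ PCMetabelian R G :=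
    lift lie_lie_lie_lie (fun y => of R G (ι y)) fun x y h => lie_of_of_adj (ι.map_adj_iff.2 h)
  let g : PCMetabelian R G →ₗ⁅R⁆ PCMetabelian R G' :=
    lift lie_lie_lie_lie (fun x => if h : ∃ y, ι y = x then of R G' h.choose else 0)
      fun x x' h => by
        split_ifs with h₁ h₂
        · refine lie_of_of_adj (ι.map_adj_iff.1 ?_)
          rwa [h₁.choose_spec, h₂.choose_spec]
        · rw [lie_zero]
        · rw [zero_lie]
        · rw [zero_lie]
  have hgf : g.comp f = LieHom.id := hom_ext fun y => by
    have h : ∃ y', ι y' = ι y := ⟨y, rfl⟩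
    have h' : h.choose = y := ι.injective h.choose_spec
    simp [f, g]
  exact .of_injective f (Function.LeftInverse.injective (g := g) (LieHom.congr_fun hgf))

end Embedding

section Twins

variable (ι : G' ↪g G) {ρ : X → Y}

theorem mem_perp_iff_of_twins (hρ : ∀ x, PerpEquiv G x (ι (ρ x))) (x x' : X) : x' ∈ perp G x ↔ ρ x' ∈ perp G' (ρ x) :=
  ((hρ x).mem_perp_iff_mem_perp (hρ x')).trans ι.mem_perp_iff

theorem lie_of_of_twins (hρ : ∀ x, PerpEquiv G x (ι (ρ x))) {x x' : X} (h : G.Adj x x') : ⁅of R G' (ρ x), of R G' (ρ x')⁆ = 0 := by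
  have h' := (mem_perp_iff_of_twins ι hρ x x').1 (mem_perp_iff.2 (Or.inl h))
  rcases mem_perp_iff.1 h' with h' | h'
  · exact lie_of_of_adj h'
  · rw [h', lie_self]

/-- The homomorphism `M(X;G) → M(Y;G')` sending a vertex `x` to `τ x` times its twin. -/
noncomputable def scaledCollapse (hρ : ∀ x, PerpEquiv G x (ι (ρ x))) (τ : X → R) : PCMetabelian R G →ₗ⁅R⁆ PCMetabelian R G' :=
  lift lie_lie_lie_lie (fun x => τ x • of R G' (ρ x)) fun x x' h => by
    rw [smul_lie, lie_smul, lie_of_of_twins ι hρ h, smul_zero, smul_zero]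

/-- Vertices in one fibre of `ρ` are equal or adjacent, so their values commute and lie on one line.
`q` picks a nonzero value in the fibre if there is one, and zero otherwise. -/
theorem exists_eq_smul_of_twins (hρ : ∀ x, PerpEquiv G x (ι (ρ x)))
    {K : Type*} [Field K] (p : X → AffineLie K)
    (hp : ∀ x y, G.Adj x y → ⁅p x, p y⁆ = 0) :
    ∃ (c : X → K) (q : Y → AffineLie K), (∀ x, p x = c x • q (ρ x)) ∧
      ∀ x y, G'.Adj x y → ⁅q x, q y⁆ = 0 := by
  classical
  have hp' : ∀ x x', ρ x' ∈ perp G' (ρ x) → ⁅p x, p x'⁆ = 0 := by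
    intro x x' h
    rcases mem_perp_iff.1 ((mem_perp_iff_of_twins ι hρ x x').2 h) with h | rfl
    · exact hp _ _ h
    · exact lie_self _
  let q : Y → AffineLie K := fun y => if h : ∃ x, ρ x = y ∧ p x ≠ 0 then p h.choose else 0
  have hq : ∀ y, q y ≠ 0 → ∃ x, ρ x = y ∧ q y = p x := by
    intro y hy
    by_cases h : ∃ x, ρ x = y ∧ p x ≠ 0
    · exact ⟨h.choose, h.choose_spec.1, dif_pos h⟩
    · exact absurd (dif_neg h) hy
  have hc : ∀ x, ∃ c : K, p x = c • q (ρ x) := by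
    intro x
    by_cases hx : p x = 0
    · exact ⟨0, by rw [hx, zero_smul]⟩
    · have h : ∃ x', ρ x' = ρ x ∧ p x' ≠ 0 := ⟨x, rfl, hx⟩
      have hqx : q (ρ x) = p h.choose := dif_pos h
      rw [hqx]
      exact AffineLie.exists_smul_eq h.choose_spec.2
        (hp' _ _ (mem_perp_iff.2 (Or.inr h.choose_spec.1)))
  choose c hc using hc
  refine ⟨c, q, hc, fun y y' h => ?_⟩
  by_cases hy : q y = 0
  · rw [hy, zero_lie]
  by_cases hy' : q y' = 0
  · rw [hy', lie_zero]
  obtain ⟨x, rfl, hx⟩ := hq y hy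
  obtain ⟨x', rfl, hx'⟩ := hq y' hy'
  rw [hx, hx']
  exact hp' _ _ (mem_perp_iff.2 (Or.inl h))

/-- In `p x = c x • q (ρ x)` replace `c x` by an indeterminate. Specializing the generic point `P`
to `c` recovers `p`, so its value at `z` is nonzero; specializing to `τ` factors through
`scaledCollapse`. A nonzero coordinate of that value serves as `h`. -/
theorem exists_polynomial_of_eval_ne_zero (hρ : ∀ x, PerpEquiv G x (ι (ρ x)))
    {K : Type*} [Field K] [Algebra R K]
    (p : X → AffineLie K) (hp : ∀ x y, G.Adj x y → ⁅p x, p y⁆ = 0) {z : PCMetabelian R G}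
    (hz : eval p hp z ≠ 0) :
    ∃ h : MvPolynomial X K, h ≠ 0 ∧ ∀ τ : X → R,
      MvPolynomial.eval (fun x => algebraMap R K (τ x)) h ≠ 0 →
        scaledCollapse ι hρ τ z ≠ 0 := by
  obtain ⟨c, q, hc, hq⟩ := exists_eq_smul_of_twins ι hρ p hp
  have hq' : ∀ x x', G.Adj x x' → ⁅q (ρ x), q (ρ x')⁆ = 0 := fun x x' h => by
    rcases mem_perp_iff.1 ((mem_perp_iff_of_twins ι hρ x x').1 (mem_perp_iff.2 (Or.inl h)))
      with h' | h'
    · exact hq _ _ h'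
    · rw [h', lie_self]
  let C : K →ₐ[R] MvPolynomial X K := IsScalarTower.toAlgHom R K (MvPolynomial X K)
  let P : X → AffineLie (MvPolynomial X K) := fun x =>
    (MvPolynomial.X x : MvPolynomial X K) • AffineLie.map C (q (ρ x))
  have hP : ∀ x x', G.Adj x x' → ⁅P x, P x'⁆ = 0 := fun x x' h => by
    simp only [P]
    rw [smul_lie, lie_smul, ← LieHom.map_lie, hq' x x' h, map_zero, smul_zero, smul_zero]
  let ev : (X → K) → (MvPolynomial X K →ₐ[R] K) := fun t =>
    (MvPolynomial.aeval t : MvPolynomial X K →ₐ[K] K).restrictScalars R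
  have hev : ∀ t x, AffineLie.map (ev t) (P x) = t x • q (ρ x) := by
    intro t x
    ext <;> simp [P, ev, C, MvPolynomial.algebraMap_eq]
  have hne : eval P hP z ≠ 0 := by
    intro h
    apply hz
    rw [← map_eval (ev c) P hP p hp (fun x => by rw [hev, hc]) z, h, map_zero]
  have hτ : ∀ (τ : X → R), AffineLie.map (ev fun x => algebraMap R K (τ x)) (eval P hP z) =
      eval q hq (scaledCollapse ι hρ τ z) := by
    intro τ
    have : (AffineLie.map (ev fun x => algebraMap R K (τ x))).comp (eval P hP) =
        (eval q hq).comp (scaledCollapse ι hρ τ) := hom_ext fun x => by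
      rw [LieHom.comp_apply, LieHom.comp_apply, eval_of, hev, scaledCollapse, lift_of, map_smul,
        eval_of]
      ext <;> simp [Algebra.smul_def]
    exact LieHom.congr_fun this z
  have key : ∀ τ : X → R, scaledCollapse ι hρ τ z = 0 →
      MvPolynomial.eval (fun x => algebraMap R K (τ x)) (eval P hP z).fst = 0 ∧
      MvPolynomial.eval (fun x => algebraMap R K (τ x)) (eval P hP z).snd = 0 := by
    intro τ h
    have := hτ τ
    rw [h, map_zero, AffineLie.ext_iff] at this
    simpa [ev, MvPolynomial.aeval_eq_eval] using this
  by_cases h1 : (eval P hP z).fst = 0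
  · exact ⟨(eval P hP z).snd, fun h2 => hne (AffineLie.ext h1 h2),
      fun τ h h0 => h (key τ h0).2⟩
  · exact ⟨(eval P hP z).fst, h1, fun τ h h0 => h (key τ h0).1⟩

theorem isDiscriminatedBy_of_twins (hρ : ∀ x, PerpEquiv G x (ι (ρ x))) [IsDomain R] [CharZero R] [Finite X] :
    IsDiscriminatedBy R (PCMetabelian R G) (PCMetabelian R G') := by
  classical
  intro F hF
  have : Infinite R := Infinite.of_injective (Nat.cast : ℕ → R) Nat.cast_injective
  -- Proportionality of twins needs a field, so the separating points are moved to fractions.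
  let K := FractionRing (MvPolynomial X R)
  have hpoly : ∀ z : PCMetabelian R G, z ∈ F → ∃ h : MvPolynomial X K, h ≠ 0 ∧ ∀ τ : X → R,
      MvPolynomial.eval (fun x => algebraMap R K (τ x)) h ≠ 0 →
        scaledCollapse ι hρ τ z ≠ 0 := by
    intro z hz
    obtain ⟨p, hp, hne⟩ := exists_eval_ne_zero (hF z hz)
    let f : MvPolynomial X R →ₐ[R] K := IsScalarTower.toAlgHom R (MvPolynomial X R) K
    have hf : Function.Injective f := IsFractionRing.injective (MvPolynomial X R) K
    have hp' : ∀ x y, G.Adj x y → ⁅AffineLie.map f (p x), AffineLie.map f (p y)⁆ = 0 :=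
      fun x y h => by rw [← LieHom.map_lie, hp x y h, map_zero]
    refine exists_polynomial_of_eval_ne_zero ι hρ (fun x => AffineLie.map f (p x)) hp' ?_
    rw [← map_eval f p hp _ hp' fun _ => rfl]
    intro h0
    have h0' := AffineLie.ext_iff.1 h0
    exact hne (AffineLie.ext (hf (h0'.1.trans (map_zero f).symm))
      (hf (h0'.2.trans (map_zero f).symm)))
  choose! h hh0 hh using hpoly
  have hprod : ∏ z ∈ F, h z ≠ 0 := Finset.prod_ne_zero_iff.2 hh0
  have hinj : Function.Injective (algebraMap R K) := by
    rw [IsScalarTower.algebraMap_eq R (MvPolynomial X R) K]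
    exact (IsFractionRing.injective (MvPolynomial X R) K).comp (MvPolynomial.C_injective X R)
  -- A nonzero polynomial over `K` cannot vanish on a grid with infinite sides, here copies of the
  -- image of `R`.
  obtain ⟨t, ht, hne⟩ : ∃ t ∈ Set.pi Set.univ (fun _ : X => Set.range (algebraMap R K)),
      MvPolynomial.eval t (∏ z ∈ F, h z) ≠ 0 := by
    by_contra! hcon
    exact hprod (MvPolynomial.funext_set (fun _ => Set.range (algebraMap R K))
      (fun _ => Set.infinite_range_of_injective hinj) fun t ht => by rw [hcon t ht, map_zero])
  choose τ hτ using fun x => ht x (Set.mem_univ x)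
  obtain rfl : (fun x => algebraMap R K (τ x)) = t := funext hτ
  rw [map_prod] at hne
  exact ⟨scaledCollapse ι hρ τ, fun z hz => hh z hz τ (Finset.prod_ne_zero_iff.1 hne z hz)⟩

end Twins

/-- If every vertex of `G` has a twin in an induced subgraph, then the subgraph has a universally
equivalent algebra. -/
theorem universallyEquivalent_of_twins [IsDomain R] [CharZero R] [Finite X] (ι : G' ↪g G)
    (h : ∀ x, ∃ y, PerpEquiv G x (ι y)) :
    UniversallyEquivalent R (PCMetabelian R G) (PCMetabelian R G') := by
  choose ρ hρ using h
  exact universallyEquivalent_of_isDiscriminatedBy (isDiscriminatedBy_of_twins ι hρ)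
    (isDiscriminatedBy_of_embedding ι)

end PCMetabelian

/-! ### Central elements and the algebras of trees -/

theorem SimpleGraph.IsTree.not_triangle {V : Type v} {T : SimpleGraph V} (hT : T.IsTree)
    {a b c : V} (hab : T.Adj a b) (hac : T.Adj a c) : ¬ T.Adj b c := by
  intro hbc
  obtain ⟨C⟩ := hT.colorable_two
  have h1 := C.valid hab
  have h2 := C.valid hac
  have h3 := C.valid hbc
  omega

namespace PCMetabelian

variable {R : Type u} [CommRing R] {V : Type v} {T : SimpleGraph V}

/-- Dropping the second coordinate is an endomorphism of the test algebra, so first coordinates of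
values depend only on first coordinates of `p`. -/
theorem coord_eq_fst_eval (i : V) (p : V → AffineLie R)
    (hp : ∀ x y, T.Adj x y → ⁅p x, p y⁆ = 0) (h : ∀ x, (p x).fst = (coordPoint R i x).fst)
    (z : PCMetabelian R T) : (eval p hp z).fst = coord R T i z := by
  let π : AffineLie R →ₗ⁅R⁆ AffineLie R :=
    { toFun := fun a => ⟨a.fst, 0⟩
      map_add' := fun _ _ => by ext <;> simp
      map_smul' := fun _ _ => by ext <;> simp
      map_lie' := by intros; ext <;> simp }
  have key : π.comp (eval p hp) = eval (coordPoint R i) (fun x y _ => lie_coordPoint i x y) :=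
    hom_ext fun x => by
      rw [LieHom.comp_apply, eval_of, eval_of]
      exact AffineLie.ext (h x) rfl
  have h' : π (eval p hp z) = _ := LieHom.congr_fun key z
  exact (AffineLie.ext_iff.1 h').1

/-- The linear part of a central element involves only vertices adjacent to all others. -/
theorem adj_of_coord_ne_zero {z : PCMetabelian R T} (hz : ∀ t : PCMetabelian R T, ⁅z, t⁆ = 0) {i j : V}
    (hi : coord R T i z ≠ 0) (hij : i ≠ j) : T.Adj i j := by
  classical
  by_contra hadj
  -- Vertex `i` goes to `e`, `j` to `f`, all others to zero; this is allowed as `i` and `j` are not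
  -- adjacent. Bracketing with `j` then reads off coordinate `i`.
  let p : V → AffineLie R := fun x => ⟨if x = i then 1 else 0, if x = j then 1 else 0⟩
  have hp : ∀ x y, T.Adj x y → ⁅p x, p y⁆ = 0 := by
    intro x y h
    rw [AffineLie.lie_eq_zero_iff]
    simp only [p]
    by_cases hx : x = i
    · by_cases hy : y = j
      · subst hx hy
        exact absurd h hadj
      · have hxj : x ≠ j := fun h' => hij (hx.symm.trans h')
        simp [hy, hxj]
    · by_cases hx' : x = j
      · have hy : y ≠ i := fun hy => hadj (by subst hx' hy; exact h.symm)
        simp [hx, hy]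
      · simp [hx, hx']
  have h0 : eval p hp ⁅z, of R T j⁆ = 0 := by rw [hz, map_zero]
  rw [LieHom.map_lie, eval_of, AffineLie.lie_eq_zero_iff,
    coord_eq_fst_eval i p hp (fun x => by simp [p, coordPoint])] at h0
  apply hi
  simpa [p, hij.symm] using h0

/-- A graph with two vertices adjacent to all others and two non-adjacent vertices does not have
the algebra of a tree. -/
theorem isEmpty_lieEquiv_of_isTree [Nontrivial R] {X : Type w} {H : SimpleGraph X} {a b c d : X}
    (hab : a ≠ b) (ha : ∀ x, a ≠ x → H.Adj a x) (hb : ∀ x, b ≠ x → H.Adj b x)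
    (hcd : c ≠ d) (hcd' : ¬ H.Adj c d) (hT : T.IsTree) :
    IsEmpty (PCMetabelian R H ≃ₗ⁅R⁆ PCMetabelian R T) := by
  classical
  refine ⟨fun e => ?_⟩
  have hcentral : ∀ x, (∀ y, x ≠ y → H.Adj x y) → ∀ t : PCMetabelian R H, ⁅of R H x, t⁆ = 0 := fun x hx =>
    lie_eq_zero_of_lie_of_eq_zero fun y => by
      by_cases h : x = y
      · rw [h, lie_self]
      · exact lie_of_of_adj (hx y h)
  have hcentral' : ∀ x, (∀ y, x ≠ y → H.Adj x y) →
      ∀ t : PCMetabelian R T, ⁅e (of R H x), t⁆ = 0 := fun x hx t => by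
    rw [← e.apply_symm_apply t, ← LieEquiv.map_lie, hcentral x hx, map_zero]
  -- The inverse isomorphism maps commutators to commutators, so a vanishing linear part is
  -- transported back.
  have hcoord : ∀ z, (∀ i, coord R T i (e z) = 0) → ∀ x, coord R H x z = 0 := fun z hz x => by
    have := fst_eq_zero_of_mem_wordSpan ((eval (G := H) (coordPoint R x)
      fun y y' _ => lie_coordPoint x y y').comp e.symm.toLieHom) (mem_wordSpan_of_coord_eq_zero hz)
    rw [LieHom.comp_apply] at this
    simpa [coord_apply] using this
  obtain ⟨i, hi⟩ : ∃ i, coord R T i (e (of R H a)) ≠ 0 := by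
    by_contra! hcon
    have := hcoord _ hcon a
    rw [coord_of, if_pos rfl] at this
    exact one_ne_zero this
  have hi' : ∀ j, i ≠ j → T.Adj i j := fun j hij => adj_of_coord_ne_zero (hcentral' a ha) hi hij
  -- Otherwise the algebra of `T`, hence that of `H`, would be abelian, making `c` central although
  -- it is not adjacent to `d`.
  obtain ⟨u, v, huv, huv'⟩ : ∃ u v, u ≠ v ∧ ¬ T.Adj u v := by
    by_contra! hcon
    have h1 : ∀ x, ∀ t : PCMetabelian R T, ⁅of R T x, t⁆ = 0 := fun x =>
      lie_eq_zero_of_lie_of_eq_zero fun y => by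
      by_cases h : x = y
      · rw [h, lie_self]
      · exact lie_of_of_adj (hcon x y h)
    have h2 : ∀ z t : PCMetabelian R T, ⁅z, t⁆ = 0 := fun z =>
      lie_eq_zero_of_lie_of_eq_zero fun x => by rw [← lie_skew, h1, neg_zero]
    have h3 : ∀ t : PCMetabelian R H, ⁅of R H c, t⁆ = 0 := fun t => e.injective <| by
      rw [LieHom.map_lie, h2, map_zero]
    exact hcd' (adj_of_coord_ne_zero h3 (by rw [coord_of, if_pos rfl]; exact one_ne_zero) hcd)
  -- A second vertex adjacent to all others would form a triangle with `i` and `u`.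
  have hunique : ∀ j, i ≠ j → ¬ ∀ k, j ≠ k → T.Adj j k := by
    intro j hij hj
    have hiu : i ≠ u := fun h => huv' (h ▸ hi' v (h ▸ huv))
    have hju : j ≠ u := fun h => huv' (h ▸ hj v (h ▸ huv))
    exact hT.not_triangle (hi' j hij) (hi' u hiu) (hj u hju)
  have hzero : ∀ x, (∀ y, x ≠ y → H.Adj x y) → ∀ j, i ≠ j → coord R T j (e (of R H x)) = 0 := by
    intro x hx j hij
    by_contra hne
    exact hunique j hij fun k hjk => adj_of_coord_ne_zero (hcentral' x hx) hne hjk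
  -- The images of `a` and `b` have linear parts supported at `i` alone; this combination cancels
  -- them, yet its coordinate at `b` is minus the nonzero `i`-coordinate of the image of `a`.
  have hcomb := hcoord (coord R T i (e (of R H b)) • of R H a -
    coord R T i (e (of R H a)) • of R H b) (fun j => by
      rw [map_sub, map_smul, map_smul, map_sub, map_smul, map_smul]
      by_cases hij : i = j
      · subst hij
        simp only [smul_eq_mul]
        ring
      · rw [hzero a ha j hij, hzero b hb j hij, smul_zero, smul_zero, sub_zero]) b
  rw [map_sub, map_smul, map_smul, coord_of, coord_of, if_neg hab, if_pos rfl] at hcomb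
  apply hi
  simpa using hcomb

end PCMetabelian

/-- The path with three vertices and its centre `0` doubled by a twin `3`. -/
def doubledStar : SimpleGraph (Fin 4) :=
  SimpleGraph.fromRel fun x _ => x = 0 ∨ x = 3

/-- The star with centre `0` as an induced subgraph of its doubling. -/
def starEmbedding : SimpleGraph.starGraph (0 : Fin 3) ↪g doubledStar where
  toFun := Fin.castSucc
  inj' := Fin.castSucc_injective 3
  map_rel_iff' := by
    intro a b
    simp only [doubledStar, SimpleGraph.fromRel_adj, SimpleGraph.starGraph_adj,
      Function.Embedding.coeFn_mk]
    revert a b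
    decide

theorem exists_perpEquiv_starEmbedding (x : Fin 4) :
    ∃ y, PerpEquiv doubledStar x (starEmbedding y) := by
  by_cases hx : x = 3
  · refine ⟨0, Set.ext fun y => ?_⟩
    rw [mem_perp_iff, mem_perp_iff]
    subst hx
    simp only [doubledStar, SimpleGraph.fromRel_adj]
    change _ ↔ ((0 : Fin 4) ≠ y ∧ _) ∨ (0 : Fin 4) = y
    revert y
    decide
  · exact ⟨x.castPred hx, congrArg (perp doubledStar) (Fin.castSucc_castPred x hx).symm⟩

theorem mainTheorem2 (R : Type u) [CommRing R] [IsDomain R] [CharZero R] :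
    -- deleting a vertex whose class has at least two elements
    (∀ (X : Type v) [Finite X] (G : SimpleGraph X) (x : X), (perpClass G x).Nontrivial →
      UniversallyEquivalent R (PCMetabelian R G) (PCMetabelian R (G.induce {x}ᶜ))) ∧
    -- every compaction
    (∀ (X : Type v) [Finite X] (G : SimpleGraph X) (S : Set X), IsPerpTransversal G S →
      UniversallyEquivalent R (PCMetabelian R G) (PCMetabelian R (G.induce S))) ∧
    -- the algebras of trees are not separable by universal theory
    (∃ (m n : ℕ) (T : SimpleGraph (Fin m)) (H : SimpleGraph (Fin n)),
      T.IsTree ∧ ¬ H.IsTree ∧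
      (∀ (k : ℕ) (T' : SimpleGraph (Fin k)), T'.IsTree →
        IsEmpty (PCMetabelian R H ≃ₗ⁅R⁆ PCMetabelian R T')) ∧
      UniversallyEquivalent R (PCMetabelian R T) (PCMetabelian R H)) := by
  refine ⟨fun X _ G x hx => ?_, fun X _ G S hS => ?_,
    3, 4, SimpleGraph.starGraph 0, doubledStar, SimpleGraph.isTree_starGraph 0, ?_, ?_, ?_⟩
  · refine PCMetabelian.universallyEquivalent_of_twins (SimpleGraph.Embedding.induce _) fun z => ?_
    by_cases hz : z = x
    · obtain ⟨y, hy, hyx⟩ := hx.exists_ne x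
      exact ⟨⟨y, hyx⟩, hz ▸ hy⟩
    · exact ⟨⟨z, hz⟩, rfl⟩
  · refine PCMetabelian.universallyEquivalent_of_twins (SimpleGraph.Embedding.induce _) fun z => ?_
    obtain ⟨s, ⟨hs, hzs⟩, -⟩ := hS z
    exact ⟨⟨s, hs⟩, hzs⟩
  · intro h
    exact h.not_triangle (a := 0) (b := 3) (c := 1) (by simp [doubledStar]) (by simp [doubledStar])
      (by simp [doubledStar])
  · intro k T' hT'
    exact PCMetabelian.isEmpty_lieEquiv_of_isTree (a := 0) (b := 3) (c := 1) (d := 2) (by decide)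
      (fun x hx => by simpa [doubledStar] using hx) (fun x hx => by simpa [doubledStar] using hx)
      (by decide) (by simp [doubledStar]) hT'
  · exact (PCMetabelian.universallyEquivalent_of_twins starEmbedding
      exists_perpEquiv_starEmbedding).symm
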